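/- A tournament is a set of vertices with an irreflexive, antisymmetric, complete binary relation $E$ (write $x\to y$ for $(x,y)\in E$); it is acyclic if it contains no $3$-cycle. A tournament $S$ embeds in $T$ if $S$ is isomorphic to a subtournament of $T$ (the tournament induced on a subset of the vertices). Given a tournament $D$ and tournaments $T_i$ ($i\in V(D)$), their lexicographical sum indexed by $D$ is the tournament on the disjoint union of the $V(T_i)$ in which $(x,i)\to(y,j)$ if either $i=j$ and $x\to y$ in $T_i$, or $i\to j$ in $D$. Let $\mathfrak A$ be the class of tournaments that are (isomorphic to) a lexicographical sum of acyclic tournaments indexed by a finite tournament. For an acyclic tournament $C=(A,<)$ define six tournaments. $C_{3[C]}$ is the lexicographical sum of copies of the $3$-cycle indexed by $C$. $V_{[C]}$ has vertex set $(A\times\{0,1\})\cup\{a\}$ with $(x,i)\to(x',i')$ if $x<x'$, or $x=x'$ and $i<i'$; $a\to(x,0)$ and $(x,1)\to a$ for all $x\in A$. The tournaments $T_{[C]},U_{[C]},H_{[C]},K_{[C]}$ have vertex set $A\times\{0,1\}$; in each of them $(x,0)\to(x,1)$ for all $x\in A$, and for all $x<y$ in $A$ one has $(x,0)\to(y,0)$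 together with: - in $T_{[C]}$: $(y,1)\to(x,0)$, $(y,0)\to(x,1)$, $(x,1)\to(y,1)$; - in $U_{[C]}$: $(x,0)\to(y,1)$, $(x,1)\to(y,0)$, $(y,1)\to(x,1)$; - in $H_{[C]}$: $(y,1)\to(x,0)$, $(x,1)\to(y,0)$, $(x,1)\to(y,1)$; - in $K_{[C]}$: $(y,1)\to(x,0)$, $(x,1)\to(y,0)$, $(y,1)\to(x,1)$. Let $\mathfrak B$ be the set of the tournaments $C_{3[C]},V_{[C]},T_{[C]},U_{[C]},H_{[C]},K_{[C]}$ for $C=\omega=(\mathbb N,<)$ and for $C=\omega^*$, the dual of $\omega$. Then: 1. Every infinite tournament either is a lexicographical sum of acyclic tournaments indexed by a finite tournament, or contains a subtournament isomorphic to a member of $\mathfrak B$. 2. $\mathfrak B$ has exactly twelve members, and no member of $\mathfrak B$ embeds in another one. 3. $\mathfrak B$ is a set of obstructions characterizing $\mathfrak A$, of minimum size. That is: no member of $\mathfrak B$ belongs to $\mathfrak A$, and an arbitrary tournament belongs to $\mathfrak A$ if and only if no member of $\mathfrak B$ embeds in it (so the two cases in 1 exclude each other); and every set $\mathcal S$ of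 tournaments with these two properties has at least as many members as $\mathfrak B$. -/

import Mathlib

universe u v

/-- A tournament: an irreflexive, antisymmetric and complete binary relation `E` (the edges) on
a type `V` (the vertices). -/
structure Tournament : Type (u + 1) where
  /-- the vertices -/
  V : Type u
  /-- the edges -/
  E : V → V → Prop
  irrefl : ∀ x, ¬ E x x
  asymm : ∀ x y, E x y → ¬ E y x
  total : ∀ x y, x ≠ y → E x y ∨ E y x

namespace Tournament

/-- `S` is embeddable into `T`: there is an isomorphism from `S` onto a subtournament of `T`. -/
def Embeds (S : Tournament.{u}) (T : Tournament.{v}) : Prop :=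
  Nonempty (S.E ↪r T.E)

/-- `S` and `T` are isomorphic. -/
def Iso (S : Tournament.{u}) (T : Tournament.{v}) : Prop :=
  Nonempty (S.E ≃r T.E)

/-- A tournament is acyclic if it contains no `3`-cycle. -/
def Acyclic (T : Tournament.{u}) : Prop :=
  ∀ x y z, ¬ (T.E x y ∧ T.E y z ∧ T.E z x)

/-- The dual tournament, with all edges reversed. -/
def dual (T : Tournament.{u}) : Tournament.{u} where
  V := T.V
  E x y := T.E y x
  irrefl := T.irrefl
  asymm x y h := T.asymm y x h
  total x y h := (T.total x y h).symm

/-- The lexicographical sum of the tournaments `F i` indexed by the tournament `D`. -/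
def lexSum (D : Tournament.{u}) (F : D.V → Tournament.{v}) : Tournament.{max u v} where
  V := Σ i, (F i).V
  E := Sigma.Lex D.E fun i => (F i).E
  irrefl := by
    rintro ⟨i, x⟩ h
    cases h with
    | left _ _ h => exact D.irrefl i h
    | right _ _ h => exact (F i).irrefl x h
  asymm := by
    rintro ⟨i, x⟩ ⟨j, y⟩ h h'
    cases h with
    | left _ _ h =>
      cases h' with
      | left _ _ h' => exact D.asymm _ _ h h'
      | right _ _ _ => exact D.irrefl _ h
    | right _ _ h =>
      cases h' with
      | left _ _ h' => exact D.irrefl _ h'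
      | right _ _ h' => exact (F _).asymm _ _ h h'
  total := by
    rintro ⟨i, x⟩ ⟨j, y⟩ h
    by_cases hij : i = j
    · subst hij
      have hxy : x ≠ y := fun e => h (by rw [e])
      rcases (F i).total x y hxy with e | e
      · exact Or.inl (Sigma.Lex.right _ _ e)
      · exact Or.inr (Sigma.Lex.right _ _ e)
    · rcases D.total i j hij with e | e
      · exact Or.inl (Sigma.Lex.left _ _ e)
      · exact Or.inr (Sigma.Lex.left _ _ e)

/-- `T` is (isomorphic to) a lexicographical sum of acyclic tournaments indexed by a finite
tournament. -/
def IsFiniteSumOfAcyclic (T : Tournament.{u}) : Prop :=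
  ∃ (D : Tournament.{u}) (F : D.V → Tournament.{u}),
    Finite D.V ∧ (∀ i, (F i).Acyclic) ∧ T.Iso (lexSum D F)

/-- The acyclic tournament made of the natural numbers and their strict order. -/
def chainOmega : Tournament.{0} where
  V := ℕ
  E x y := x < y
  irrefl := lt_irrefl
  asymm _ _ h := lt_asymm h
  total _ _ h := lt_or_gt_of_ne h

/-- The dual of `chainOmega`. -/
def chainOmegaStar : Tournament.{0} := chainOmega.dual

/-- The `3`-cycle `0 → 1 → 2 → 0`. -/
def cycle3 : Tournament.{0} where
  V := Fin 3
  E x y := y = x + 1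
  irrefl := by decide
  asymm := by decide
  total := by decide

/-- `C_{3[C]}`: the lexicographical product of the `3`-cycle by `C`, i.e. the lexicographical sum
of copies of the `3`-cycle indexed by `C`. -/
def C3 (C : Tournament.{u}) : Tournament.{u} :=
  lexSum C fun _ => cycle3

/-- The edges of `V_{[C]}`; the extra vertex `a` is `none`. -/
def VRel (C : Tournament.{u}) : Option (C.V × Fin 2) → Option (C.V × Fin 2) → Prop
  | some (x, i), some (y, j) => C.E x y ∨ (x = y ∧ i < j)
  | none, some (_, j) => j = 0
  | some (_, i), none => i = 1
  | none, none => False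

/-- `V_{[C]}`. -/
def VT (C : Tournament.{u}) : Tournament.{u} where
  V := Option (C.V × Fin 2)
  E := C.VRel
  irrefl := by
    rintro (_ | ⟨x, i⟩)
    · exact id
    · rintro (h | ⟨-, h⟩)
      · exact C.irrefl x h
      · exact lt_irrefl i h
  asymm := by
    rintro (_ | ⟨x, i⟩) (_ | ⟨y, j⟩) h h'
    · exact h
    · simp only [VRel] at h h'
      omega
    · simp only [VRel] at h h'
      omega
    · rcases h with h | ⟨rfl, h⟩ <;> rcases h' with h' | ⟨e, h'⟩
      · exact C.asymm x y h h'
      · exact C.irrefl x (e ▸ h)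
      · exact C.irrefl _ h'
      · exact lt_asymm h h'
  total := by
    rintro (_ | ⟨x, i⟩) (_ | ⟨y, j⟩) h
    · exact absurd rfl h
    · simp only [VRel]
      omega
    · simp only [VRel]
      omega
    · by_cases hxy : x = y
      · subst hxy
        have hij : i ≠ j := fun e => h (by rw [e])
        rcases lt_or_gt_of_ne hij with hl | hl
        · exact Or.inl (Or.inr ⟨rfl, hl⟩)
        · exact Or.inr (Or.inr ⟨rfl, hl⟩)
      · exact (C.total x y hxy).imp Or.inl Or.inl

/-- A pair of elements of `{0, 1} × {0, 1}`. -/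
abbrev Pair2 : Type := (Fin 2 × Fin 2) × (Fin 2 × Fin 2)

/-- `h_i = ((0, i), (1, i))`. -/
def hp (i : Fin 2) : Pair2 := ((0, i), (1, i))

/-- `v_i = ((i, 0), (i, 1))`. -/
def vp (i : Fin 2) : Pair2 := ((i, 0), (i, 1))

/-- `d_i = ((0, i), (1, i + 1))`, with `i + 1` taken modulo `2`. -/
def dp (i : Fin 2) : Pair2 := ((0, i), (1, i + 1))

/-- The edges of the directed graph `Δ(C, X)` on `C × {0, 1}`. -/
def DeltaRel (C : Tournament.{u}) (X : Finset Pair2) (p q : C.V × Fin 2) : Prop :=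
  (p.1 = q.1 ∧ ((0, p.2), (0, q.2)) ∈ X) ∨
  (C.E p.1 q.1 ∧ ((0, p.2), (1, q.2)) ∈ X) ∨
  (C.E q.1 p.1 ∧ ((1, p.2), (0, q.2)) ∈ X)

/-- The sets `X` for which `Δ(C, X)` is a tournament. -/
def Good (X : Finset Pair2) : Prop :=
  (∀ i : Fin 2, ((0, i), (0, i)) ∉ X) ∧
  (∀ i j : Fin 2, i ≠ j → (((0, i), (0, j)) ∈ X ↔ ((0, j), (0, i)) ∉ X)) ∧
  (∀ i j : Fin 2, ((0, i), (1, j)) ∈ X ↔ ((1, j), (0, i)) ∉ X)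

/-- The tournament `Δ(C, X)`. -/
def Delta (C : Tournament.{u}) (X : Finset Pair2) (hX : Good X) : Tournament.{u} where
  V := C.V × Fin 2
  E := C.DeltaRel X
  irrefl := by
    rintro ⟨x, i⟩ (h | h | h)
    · exact hX.1 i h.2
    · exact C.irrefl x h.1
    · exact C.irrefl x h.1
  asymm := by
    rintro ⟨x, i⟩ ⟨y, j⟩ h h'
    obtain ⟨h1, h2, h3⟩ := hX
    have hi := C.irrefl
    have ha := C.asymm x y
    simp only [DeltaRel] at h h'
    by_cases hxy : x = y
    · subst hxy
      have hi := C.irrefl x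
      by_cases hij : i = j
      · subst hij
        have := h1 i
        tauto
      · have := h2 i j hij
        tauto
    · have hyx : ¬ y = x := fun e => hxy e.symm
      have := h3 i j
      have := h3 j i
      tauto
  total := by
    rintro ⟨x, i⟩ ⟨y, j⟩ h
    obtain ⟨h1, h2, h3⟩ := hX
    simp only [DeltaRel]
    by_cases hxy : x = y
    · subst hxy
      have hij : i ≠ j := fun e => h (by rw [e])
      have := h2 i j hij
      tauto
    · have := C.total x y hxy
      have := h3 i j
      have := h3 j i
      tauto

/-- The set `X` defining `T_{[C]}`: `d_0⁻¹, d_1⁻¹, h_1, h_0, v_0`. -/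
def XT : Finset Pair2 := {(dp 0).swap, (dp 1).swap, hp 1, hp 0, vp 0}

/-- The set `X` defining `U_{[C]}`: `d_0, d_1, h_1⁻¹, h_0, v_0`. -/
def XU : Finset Pair2 := {dp 0, dp 1, (hp 1).swap, hp 0, vp 0}

/-- The set `X` defining `H_{[C]}`: `d_0⁻¹, d_1, h_1, h_0, v_0`. -/
def XH : Finset Pair2 := {(dp 0).swap, dp 1, hp 1, hp 0, vp 0}

/-- The set `X` defining `K_{[C]}`: `d_0⁻¹, d_1, h_1⁻¹, h_0, v_0`. -/
def XK : Finset Pair2 := {(dp 0).swap, dp 1, (hp 1).swap, hp 0, vp 0}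

/-- `T_{[C]}`. -/
def TT (C : Tournament.{u}) : Tournament.{u} := C.Delta XT (by unfold Good; decide)

/-- `U_{[C]}`. -/
def UT (C : Tournament.{u}) : Tournament.{u} := C.Delta XU (by unfold Good; decide)

/-- `H_{[C]}`. -/
def HT (C : Tournament.{u}) : Tournament.{u} := C.Delta XH (by unfold Good; decide)

/-- `K_{[C]}`. -/
def KT (C : Tournament.{u}) : Tournament.{u} := C.Delta XK (by unfold Good; decide)

/-- The set `𝔅_C` of the six tournaments built on `C`. -/
def frakBOf (C : Tournament.{u}) : Set Tournament.{u} :=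
  {C.C3, C.VT, C.TT, C.UT, C.HT, C.KT}

/-- The set `𝔅 = 𝔅_ω ∪ 𝔅_{ω*}`. -/
def frakB : Set Tournament.{0} := frakBOf chainOmega ∪ frakBOf chainOmegaStar

/-- `S` is a set of obstructions characterizing the finite lexicographical sums of acyclic
tournaments: no member of `S` is such a sum, and a tournament is such a sum if and only if no
member of `S` is embeddable into it. -/
def IsObstructionSet (S : Set Tournament.{v}) : Prop :=
  (∀ B ∈ S, ¬ B.IsFiniteSumOfAcyclic) ∧
  ∀ T : Tournament.{u}, T.IsFiniteSumOfAcyclic ↔ ∀ B ∈ S, ¬ B.Embeds T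

end Tournament

universe w

/-!
Call two vertices related when they lie in a common acyclic autonomous set (an interval of the
tournament without `3`-cycle). Two such sets with a common vertex have an acyclic autonomous union,
so this is an equivalence relation; a tournament is the lexicographical sum of its classes, and it
is a finite sum of acyclic tournaments exactly when there are finitely many of them.

That `x → y` are not related is witnessed by five vertices, `x` and `y` included: otherwise the
vertices between `x` and `y` form an acyclic autonomous set. If there are infinitely many classes,
choose infinitely many pairwise unrelated pairs, each with a five-vertex witness. By the infinite
Ramsey theorem we may assume that the edges between two witnesses depend only on the order of their
indices. If none of the twelve obstructions embeds, then the columns interleaved with that of `x`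
form, inside each witness, an acyclic autonomous set containing `x` and `y`, a contradiction.

An embedding of one obstruction into another sends infinitely many rows to vertices in prescribed
columns, hence it transports the pattern of edges between rows; together with the `3`-cycles inside
a row, or the vertex `a` of `V_{[C]}`, this pattern tells the twelve tournaments apart. Minimality
follows: an obstruction set `S` provides for each `B ∈ 𝔅` some `A ∈ S` embedding in `B`, some
member of `𝔅` embeds in `A`, and it can only be `B`, so `B` is determined by `A`.
-/

namespace Tournament

/-! ### Embeddings and subtournaments -/

section Basic

variable {R : Tournament.{u}} {S : Tournament.{v}} {T : Tournament.{w}}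

theorem ne_of_edge {x y : T.V} (h : T.E x y) : x ≠ y := by
  rintro rfl
  exact T.irrefl x h

theorem edge_of_not_edge {x y : T.V} (hne : x ≠ y) (h : ¬ T.E x y) : T.E y x :=
  (T.total x y hne).resolve_left h

theorem eq_iff_not_edge {x y : T.V} : x = y ↔ ¬ T.E x y ∧ ¬ T.E y x := by
  refine ⟨?_, fun h => ?_⟩
  · rintro rfl
    exact ⟨T.irrefl x, T.irrefl x⟩
  · by_contra hne
    exact h.2 (edge_of_not_edge hne h.1)

theorem edge_map_iff {g : S.V → T.V} (hg : ∀ x y, S.E x y → T.E (g x) (g y)) {x y : S.V} :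
    T.E (g x) (g y) ↔ S.E x y := by
  refine ⟨fun h => ?_, hg x y⟩
  by_contra hxy
  have hne : x ≠ y := fun e => ne_of_edge h (congrArg g e)
  exact T.asymm _ _ h (hg _ _ (edge_of_not_edge hne hxy))

theorem injective_of_map_edge {g : S.V → T.V} (hg : ∀ x y, S.E x y → T.E (g x) (g y)) :
    Function.Injective g := by
  intro x y h
  by_contra hne
  rcases S.total x y hne with e | e
  · exact ne_of_edge (hg _ _ e) h
  · exact ne_of_edge (hg _ _ e) h.symm

theorem Embeds.of_map_edge (g : S.V → T.V) (hg : ∀ x y, S.E x y → T.E (g x) (g y)) :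
    S.Embeds T :=
  ⟨⟨⟨g, injective_of_map_edge hg⟩, edge_map_iff hg⟩⟩

theorem Embeds.refl (T : Tournament.{u}) : T.Embeds T :=
  ⟨RelEmbedding.refl T.E⟩

theorem Embeds.trans (h : R.Embeds S) (h' : S.Embeds T) : R.Embeds T :=
  ⟨h.some.trans h'.some⟩

end Basic

/-- The tournament on `α` obtained by pulling back the edges of `T` along an injection. With
`f = Subtype.val` this is the subtournament induced on a set of vertices. -/
def comap {α : Type w} (T : Tournament.{u}) (f : α → T.V) (hf : Function.Injective f) :
    Tournament.{w} where
  V := α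
  E x y := T.E (f x) (f y)
  irrefl _ := T.irrefl _
  asymm _ _ := T.asymm _ _
  total _ _ h := T.total _ _ (hf.ne h)

theorem lexSum_edge_mk_iff {D : Tournament.{u}} {F : D.V → Tournament.{v}} {i : D.V}
    {x y : (F i).V} : (lexSum D F).E ⟨i, x⟩ ⟨i, y⟩ ↔ (F i).E x y := by
  refine ⟨fun h => ?_, fun h => Sigma.Lex.right _ _ h⟩
  cases h with
  | left _ _ h => exact absurd h (D.irrefl i)
  | right _ _ h => exact h

theorem lexSum_edge_iff_of_ne {D : Tournament.{u}} {F : D.V → Tournament.{v}}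
    {a b : (lexSum D F).V} (hne : a.1 ≠ b.1) : (lexSum D F).E a b ↔ D.E a.1 b.1 := by
  refine ⟨fun h => ?_, Sigma.Lex.left _ _⟩
  cases h with
  | left _ _ h => exact h
  | right _ _ h => exact absurd rfl hne

/-! ### Acyclic autonomous sets -/

/-- The vertices `x → y → z → x` form a `3`-cycle of `T`. -/
def Cycle (T : Tournament.{u}) (x y z : T.V) : Prop :=
  T.E x y ∧ T.E y z ∧ T.E z x

theorem Cycle.rotate {T : Tournament.{u}} {x y z : T.V} (h : T.Cycle x y z) : T.Cycle y z x :=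
  ⟨h.2.1, h.2.2, h.1⟩

/-- `M` is an acyclic autonomous subset (a module without `3`-cycle) of the subtournament of `T`
induced on `A`. Since `T` is a tournament, it is enough to require that the vertices of `A` outside
`M` do not distinguish those of `M` by their incoming edges. -/
structure IsAcyclicAutonomousIn (T : Tournament.{u}) (A M : Set T.V) : Prop where
  subset : M ⊆ A
  not_cycle : ∀ x ∈ M, ∀ y ∈ M, ∀ z ∈ M, ¬ T.Cycle x y z
  edge_of_edge : ∀ x ∈ M, ∀ y ∈ M, ∀ z ∈ A, z ∉ M → T.E x z → T.E y z

namespace IsAcyclicAutonomousIn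

variable {S : Tournament.{u}} {T : Tournament.{v}} {A M N : Set T.V} {x y z : T.V}

theorem singleton (hx : x ∈ A) : T.IsAcyclicAutonomousIn A {x} where
  subset := Set.singleton_subset_iff.2 hx
  not_cycle := by
    rintro _ rfl _ rfl _ rfl h
    exact T.irrefl _ h.1
  edge_of_edge := by
    rintro _ rfl _ rfl _ _ _ h
    exact h

theorem preimage (h : T.IsAcyclicAutonomousIn A M) (g : S.E ↪r T.E) :
    S.IsAcyclicAutonomousIn (g ⁻¹' A) (g ⁻¹' M) where
  subset := Set.preimage_mono h.subset
  not_cycle x hx y hy z hz hc := by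
    simp only [Cycle, ← g.map_rel_iff] at hc
    exact h.not_cycle _ hx _ hy _ hz hc
  edge_of_edge x hx y hy z hz hzM hxz := by
    rw [← g.map_rel_iff] at hxz ⊢
    exact h.edge_of_edge _ hx _ hy _ hz hzM hxz

theorem mem_of_between (h : T.IsAcyclicAutonomousIn A M) (hx : x ∈ M) (hy : y ∈ M) (hz : z ∈ A)
    (hxz : T.E x z) (hzy : T.E z y) : z ∈ M := by
  by_contra hzM
  exact T.asymm _ _ hzy (h.edge_of_edge x hx y hy z hz hzM hxz)

theorem not_cycle_of_mem (h : T.IsAcyclicAutonomousIn A M) (hx : x ∈ M) (hy : y ∈ M)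
    (hz : z ∈ A) : ¬ T.Cycle x y z := fun hc =>
  h.not_cycle x hx y hy z (h.mem_of_between hy hx hz hc.2.1 hc.2.2) hc

theorem edge_of_edge_left (h : T.IsAcyclicAutonomousIn A M) (hx : x ∈ M) (hy : y ∈ M)
    (hz : z ∈ A) (hzM : z ∉ M) (hzx : T.E z x) : T.E z y := by
  have hyz : ¬ T.E y z := fun hyz => T.asymm _ _ hzx (h.edge_of_edge y hy x hx z hz hzM hyz)
  exact edge_of_not_edge (fun e => hzM (e ▸ hy)) hyz

theorem union (hM : T.IsAcyclicAutonomousIn A M) (hN : T.IsAcyclicAutonomousIn A N)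
    (hxM : x ∈ M) (hxN : x ∈ N) : T.IsAcyclicAutonomousIn A (M ∪ N) where
  subset := Set.union_subset hM.subset hN.subset
  not_cycle a ha b hb c hc h := by
    have hA : M ∪ N ⊆ A := Set.union_subset hM.subset hN.subset
    -- two of the three vertices belong to the same of the two sets
    rcases ha with ha | ha <;> rcases hb with hb | hb <;> rcases hc with hc | hc <;>
    first
    | exact hM.not_cycle_of_mem ha hb (hA (by simp [hc])) h
    | exact hM.not_cycle_of_mem hb hc (hA (by simp [ha])) h.rotate
    | exact hM.not_cycle_of_mem hc ha (hA (by simp [hb])) h.rotate.rotate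
    | exact hN.not_cycle_of_mem ha hb (hA (by simp [hc])) h
    | exact hN.not_cycle_of_mem hb hc (hA (by simp [ha])) h.rotate
    | exact hN.not_cycle_of_mem hc ha (hA (by simp [hb])) h.rotate.rotate
  edge_of_edge a ha b hb z hz hzMN haz := by
    obtain ⟨hzM, hzN⟩ := not_or.1 hzMN
    have hxz : T.E x z := ha.elim (fun ha => hM.edge_of_edge a ha x hxM z hz hzM haz)
      (fun ha => hN.edge_of_edge a ha x hxN z hz hzN haz)
    exact hb.elim (fun hb => hM.edge_of_edge x hxM b hb z hz hzM hxz)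
      (fun hb => hN.edge_of_edge x hxN b hb z hz hzN hxz)

end IsAcyclicAutonomousIn

/-- Some acyclic autonomous subset of the subtournament of `T` on `A` contains both `x` and `y`. -/
def RelatedIn (T : Tournament.{u}) (A : Set T.V) (x y : T.V) : Prop :=
  ∃ M, T.IsAcyclicAutonomousIn A M ∧ x ∈ M ∧ y ∈ M

namespace RelatedIn

variable {T : Tournament.{u}} {A : Set T.V} {x y z : T.V}

theorem refl (hx : x ∈ A) : T.RelatedIn A x x :=
  ⟨{x}, .singleton hx, rfl, rfl⟩

theorem symm : T.RelatedIn A x y → T.RelatedIn A y x :=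
  fun ⟨M, hM, hx, hy⟩ => ⟨M, hM, hy, hx⟩

theorem trans : T.RelatedIn A x y → T.RelatedIn A y z → T.RelatedIn A x z :=
  fun ⟨M, hM, hx, hy⟩ ⟨N, hN, hy', hz⟩ => ⟨M ∪ N, hM.union hN hy hy', Or.inl hx, Or.inr hz⟩

theorem not_cycle (h : T.RelatedIn A x y) (hz : z ∈ A) : ¬ T.Cycle x y z := by
  obtain ⟨M, hM, hx, hy⟩ := h
  exact hM.not_cycle_of_mem hx hy hz

theorem edge_of_edge (h : T.RelatedIn A x y) (hz : z ∈ A) (hxz : ¬ T.RelatedIn A x z)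
    (e : T.E x z) : T.E y z := by
  obtain ⟨M, hM, hx, hy⟩ := h
  exact hM.edge_of_edge x hx y hy z hz (fun hzM => hxz ⟨M, hM, hx, hzM⟩) e

theorem edge_of_edge_left (h : T.RelatedIn A x y) (hz : z ∈ A) (hxz : ¬ T.RelatedIn A x z)
    (e : T.E z x) : T.E z y := by
  obtain ⟨M, hM, hx, hy⟩ := h
  exact hM.edge_of_edge_left hx hy hz (fun hzM => hxz ⟨M, hM, hx, hzM⟩) e

end RelatedIn

/-- The equivalence relation whose classes are the maximal acyclic autonomous sets of `T`. -/
def acyclicSetoid (T : Tournament.{u}) : Setoid T.V where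
  r := T.RelatedIn Set.univ
  iseqv := ⟨fun x => .refl (Set.mem_univ x), .symm, .trans⟩

theorem exists_fin_five_not_relatedIn {T : Tournament.{u}} {x y : T.V}
    (h : ¬ T.acyclicSetoid x y) :
    ∃ u v w, ¬ T.RelatedIn (Set.range ![x, y, u, v, w]) x y := by
  wlog hxy : T.E x y generalizing x y
  · have hne : x ≠ y := fun e => h (e ▸ T.acyclicSetoid.refl x)
    obtain ⟨u, v, w, huvw⟩ := this (fun h' => h h'.symm) (edge_of_not_edge hne hxy)
    have hrange : Set.range ![x, y, u, v, w] = Set.range ![y, x, u, v, w] := by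
      simp only [Matrix.range_cons, Matrix.range_empty, Set.union_empty, Set.singleton_union,
        Set.insert_comm x y]
    exact ⟨u, v, w, fun h' => huvw (hrange ▸ h'.symm)⟩
  by_contra! hrel
  -- The interval `[x, y]` turns out to be an acyclic autonomous set.
  let I : Set T.V := {z | (z = x ∨ T.E x z) ∧ (z = y ∨ T.E z y)}
  have hxI : x ∈ I := ⟨Or.inl rfl, Or.inr hxy⟩
  have hyI : y ∈ I := ⟨Or.inr hxy, Or.inl rfl⟩
  have not_cycle : ∀ a ∈ I, ∀ b ∈ I, ∀ z, ¬ T.Cycle a b z := by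
    intro a ha b hb z
    obtain ⟨M, hM, hx, hy⟩ := hrel a b z
    have mem_of_mem : ∀ c ∈ I, c ∈ Set.range ![x, y, a, b, z] → c ∈ M := by
      rintro c ⟨rfl | hxc, rfl | hcy⟩ hc
      exacts [hx, hx, hy, hM.mem_of_between hx hy hc hxc hcy]
    exact hM.not_cycle_of_mem (mem_of_mem a ha ⟨2, rfl⟩) (mem_of_mem b hb ⟨3, rfl⟩) ⟨4, rfl⟩
  refine h ⟨I, ⟨Set.subset_univ I, fun a ha b hb c _ => not_cycle a ha b hb c, ?_⟩, hxI, hyI⟩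
  intro a ha b hb z _ hz haz
  by_contra hbz
  have hzb : T.E z b := edge_of_not_edge (fun e => hz (e ▸ hb)) hbz
  have hxz : T.E x z := by
    rcases ha.1 with rfl | hxa
    · exact haz
    · by_contra hxz
      exact not_cycle x hxI a ha z
        ⟨hxa, haz, edge_of_not_edge (fun e => hz (e ▸ hxI)) hxz⟩
  have hzy : T.E z y := by
    rcases hb.2 with rfl | hby
    · exact hzb
    · by_contra hzy
      exact not_cycle b hb y hyI z
        ⟨hby, edge_of_not_edge (fun e => hz (e ▸ hyI)) hzy, hzb⟩
  exact hz ⟨Or.inr hxz, Or.inr hzy⟩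

/-! ### Finite lexicographical sums of acyclic tournaments -/

theorem Embeds.finite_quotient {S : Tournament.{u}} {T : Tournament.{v}} (h : S.Embeds T)
    [Finite (Quotient T.acyclicSetoid)] : Finite (Quotient S.acyclicSetoid) := by
  obtain ⟨g⟩ := h
  refine Finite.of_injective (fun q => (⟦g q.out⟧ : Quotient T.acyclicSetoid)) fun p q hpq => ?_
  obtain ⟨M, hM, hp, hq⟩ := Quotient.exact hpq
  exact Quotient.out_equiv_out.1 ⟨g ⁻¹' M, hM.preimage g, hp, hq⟩

theorem isAcyclicAutonomousIn_lexSum_fiber {D : Tournament.{u}} {F : D.V → Tournament.{v}}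
    {i : D.V} (hF : (F i).Acyclic) :
    (lexSum D F).IsAcyclicAutonomousIn Set.univ {x | x.1 = i} where
  subset := Set.subset_univ _
  not_cycle := by
    rintro ⟨i, x⟩ rfl ⟨_, y⟩ rfl ⟨_, z⟩ rfl ⟨hxy, hyz, hzx⟩
    exact hF x y z
      ⟨lexSum_edge_mk_iff.1 hxy, lexSum_edge_mk_iff.1 hyz, lexSum_edge_mk_iff.1 hzx⟩
  edge_of_edge := by
    rintro x rfl y hyx z - hz e
    rw [lexSum_edge_iff_of_ne (Ne.symm hz)] at e
    rwa [lexSum_edge_iff_of_ne (fun h => hz (h.symm.trans hyx)), hyx]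

theorem finite_quotient_lexSum {D : Tournament.{u}} {F : D.V → Tournament.{v}} [Finite D.V]
    (hF : ∀ i, (F i).Acyclic) : Finite (Quotient (lexSum D F).acyclicSetoid) :=
  Finite.of_injective (fun q : Quotient (lexSum D F).acyclicSetoid => q.out.1) fun _ q hpq =>
    Quotient.out_equiv_out.1 ⟨_, isAcyclicAutonomousIn_lexSum_fiber (hF q.out.1), hpq, rfl⟩

/-- The tournament induced on a class of `acyclicSetoid`. -/
def acyclicClass (T : Tournament.{u}) (q : Quotient T.acyclicSetoid) : Tournament.{u} :=
  T.comap (Subtype.val : {x // Quotient.mk T.acyclicSetoid x = q} → T.V) Subtype.val_injective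

theorem acyclic_acyclicClass (T : Tournament.{u}) (q : Quotient T.acyclicSetoid) :
    (T.acyclicClass q).Acyclic := by
  rintro ⟨x, hx⟩ ⟨y, hy⟩ ⟨z, -⟩
  have hxy : T.RelatedIn Set.univ x y := Quotient.exact (hx.trans hy.symm)
  exact hxy.not_cycle (Set.mem_univ z)

theorem iso_lexSum_acyclicClass (T : Tournament.{u}) :
    T.Iso (lexSum (T.comap Quotient.out Quotient.out_injective) T.acyclicClass) := by
  have map_edge : ∀ a b : (p : Quotient T.acyclicSetoid) × (T.acyclicClass p).V,
      (lexSum (T.comap Quotient.out Quotient.out_injective) T.acyclicClass).E a b →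
        T.E a.2.1 b.2.1 := by
    rintro ⟨p, x, hx⟩ ⟨q, y, hy⟩ (⟨_, _, hpq⟩ | ⟨_, _, hxy⟩)
    · have related_out {r : Quotient T.acyclicSetoid} {z : T.V} (hz : ⟦z⟧ = r) :
          T.RelatedIn Set.univ r.out z := Quotient.exact (r.out_eq.trans hz.symm)
      have not_related : ¬ T.RelatedIn Set.univ p.out q.out := fun h =>
        ne_of_edge hpq (Quotient.out_equiv_out.1 h)
      have hxq : T.E x q.out := (related_out hx).edge_of_edge (Set.mem_univ _) not_related hpq
      exact (related_out hy).edge_of_edge_left (Set.mem_univ _)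
        (fun h => not_related ((related_out hx).trans h.symm)) hxq
    · exact hxy
  exact ⟨RelIso.symm ⟨Equiv.sigmaFiberEquiv (Quotient.mk T.acyclicSetoid), edge_map_iff map_edge⟩⟩

theorem isFiniteSumOfAcyclic_iff_finite_quotient {T : Tournament.{u}} :
    T.IsFiniteSumOfAcyclic ↔ Finite (Quotient T.acyclicSetoid) := by
  constructor
  · rintro ⟨D, F, _, hF, ⟨e⟩⟩
    have := finite_quotient_lexSum hF
    exact Embeds.finite_quotient ⟨e.toRelEmbedding⟩
  · exact fun h => ⟨_, _, h, T.acyclic_acyclicClass, T.iso_lexSum_acyclicClass⟩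

theorem IsFiniteSumOfAcyclic.of_embeds {S : Tournament.{u}} {T : Tournament.{v}}
    (hT : T.IsFiniteSumOfAcyclic) (h : S.Embeds T) : S.IsFiniteSumOfAcyclic := by
  rw [isFiniteSumOfAcyclic_iff_finite_quotient] at hT ⊢
  exact h.finite_quotient

theorem not_isFiniteSumOfAcyclic_of_forall_edge {B : Tournament.{u}} {C : Tournament.{v}}
    [Infinite C.V] (g : C.V → B.V)
    (h : ∀ x y, C.E x y → ¬ B.RelatedIn Set.univ (g x) (g y)) : ¬ B.IsFiniteSumOfAcyclic := by
  rw [isFiniteSumOfAcyclic_iff_finite_quotient, not_finite_iff_infinite]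
  refine Infinite.of_injective (fun x => (⟦g x⟧ : Quotient B.acyclicSetoid)) fun x y hxy => ?_
  have related : B.RelatedIn Set.univ (g x) (g y) := Quotient.exact hxy
  by_contra hne
  exact (C.total x y hne).elim (fun e => h x y e related) (fun e => h y x e related.symm)

/-! ### Oriented sequences and the embeddings of the obstructions -/

section Embeds

variable {C : Tournament.{u}} {T : Tournament.{v}}

theorem C3_embeds (g : Fin 3 → C.V → T.V)
    (hg : ∀ i j x y, C.E x y → T.E (g i x) (g j y))
    (hcycle : ∀ i x, T.E (g i x) (g (i + 1) x)) : C.C3.Embeds T := by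
  refine Embeds.of_map_edge (fun x => g x.2 x.1) ?_
  have hcycle' : ∀ i j : Fin 3, j = i + 1 → ∀ x, T.E (g i x) (g j x) := by
    rintro i _ rfl x
    exact hcycle i x
  rintro ⟨x, i⟩ ⟨y, j⟩ (⟨_, _, h⟩ | ⟨i, j, h⟩)
  · exact hg i j x y h
  · exact hcycle' i j h x

theorem VT_embeds (a : T.V) (g : Fin 2 → C.V → T.V)
    (hg : ∀ i j x y, C.E x y → T.E (g i x) (g j y)) (hrow : ∀ x, T.E (g 0 x) (g 1 x))
    (ha₀ : ∀ x, T.E a (g 0 x)) (ha₁ : ∀ x, T.E (g 1 x) a) : C.VT.Embeds T := by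
  refine Embeds.of_map_edge (fun z => z.elim a fun x => g x.2 x.1) ?_
  rintro (_ | ⟨x, i⟩) (_ | ⟨y, j⟩) h
  · exact h.elim
  · obtain rfl : j = 0 := h
    exact ha₀ y
  · obtain rfl : i = 1 := h
    exact ha₁ x
  · rcases h with h | ⟨rfl, h⟩
    · exact hg i j x y h
    · obtain ⟨rfl, rfl⟩ : i = 0 ∧ j = 1 := by omega
      exact hrow x

theorem Delta_embeds {X : Finset Pair2} (hX : Good X) (g : Fin 2 → C.V → T.V)
    (hrow : ∀ i j, ((0, i), (0, j)) ∈ X → ∀ x, T.E (g i x) (g j x))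
    (hup : ∀ i j, ((0, i), (1, j)) ∈ X → ∀ x y, C.E x y → T.E (g i x) (g j y))
    (hdown : ∀ i j, ((1, i), (0, j)) ∈ X → ∀ x y, C.E y x → T.E (g i x) (g j y)) :
    (C.Delta X hX).Embeds T := by
  refine Embeds.of_map_edge (fun x => g x.2 x.1) ?_
  rintro ⟨x, i⟩ ⟨y, j⟩ (⟨h, hm⟩ | ⟨h, hm⟩ | ⟨h, hm⟩)
  · obtain rfl : x = y := h
    exact hrow i j hm x
  · exact hup i j hm x y h
  · exact hdown i j hm x y h

variable {p q : C.V → T.V}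

theorem TT_embeds (hpp : ∀ x y, C.E x y → T.E (p x) (p y))
    (hqp : ∀ x y, C.E x y → T.E (q y) (p x)) (hpq : ∀ x y, C.E x y → T.E (p y) (q x))
    (hqq : ∀ x y, C.E x y → T.E (q x) (q y)) (hrow : ∀ x, T.E (p x) (q x)) :
    C.TT.Embeds T := by
  refine Delta_embeds _ ![p, q] ?_ ?_ ?_ <;> intro i j <;> fin_cases i <;> fin_cases j <;>
    simp +contextual [XT, dp, hp, vp, hpp, hqp, hpq, hqq, hrow]

theorem UT_embeds (hpp : ∀ x y, C.E x y → T.E (p x) (p y))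
    (hpq : ∀ x y, C.E x y → T.E (p x) (q y)) (hqp : ∀ x y, C.E x y → T.E (q x) (p y))
    (hqq : ∀ x y, C.E x y → T.E (q y) (q x)) (hrow : ∀ x, T.E (p x) (q x)) :
    C.UT.Embeds T := by
  refine Delta_embeds _ ![p, q] ?_ ?_ ?_ <;> intro i j <;> fin_cases i <;> fin_cases j <;>
    simp +contextual [XU, dp, hp, vp, hpp, hqp, hpq, hqq, hrow]

theorem HT_embeds (hpp : ∀ x y, C.E x y → T.E (p x) (p y))
    (hqp : ∀ x y, x ≠ y → T.E (q x) (p y)) (hqq : ∀ x y, C.E x y → T.E (q x) (q y))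
    (hrow : ∀ x, T.E (p x) (q x)) : C.HT.Embeds T := by
  have hne : ∀ x y, C.E x y → T.E (q x) (p y) ∧ T.E (q y) (p x) := fun x y h =>
    ⟨hqp x y (ne_of_edge h), hqp y x (ne_of_edge h).symm⟩
  refine Delta_embeds _ ![p, q] ?_ ?_ ?_ <;> intro i j <;> fin_cases i <;> fin_cases j <;>
    simp +contextual [XH, dp, hp, vp, hpp, hne, hqq, hrow]

theorem KT_embeds (hpp : ∀ x y, C.E x y → T.E (p x) (p y))
    (hqp : ∀ x y, x ≠ y → T.E (q x) (p y)) (hqq : ∀ x y, C.E x y → T.E (q y) (q x))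
    (hrow : ∀ x, T.E (p x) (q x)) : C.KT.Embeds T := by
  have hne : ∀ x y, C.E x y → T.E (q x) (p y) ∧ T.E (q y) (p x) := fun x y h =>
    ⟨hqp x y (ne_of_edge h), hqp y x (ne_of_edge h).symm⟩
  refine Delta_embeds _ ![p, q] ?_ ?_ ?_ <;> intro i j <;> fin_cases i <;> fin_cases j <;>
    simp +contextual [XK, dp, hp, vp, hpp, hne, hqq, hrow]

end Embeds

/-- `T` itself if `o = true`, the dual of `T` if `o = false`. -/
def orient (T : Tournament.{u}) (o : Bool) : Tournament.{u} where
  V := T.V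
  E x y := cond o (T.E x y) (T.E y x)
  irrefl x := by cases o <;> exact T.irrefl x
  asymm x y := by cases o <;> exact T.asymm _ _
  total x y h := by
    cases o
    · exact (T.total x y h).symm
    · exact T.total x y h

theorem orient_not_edge_iff {T : Tournament.{u}} {o : Bool} {x y : T.V} :
    (T.orient !o).E x y ↔ (T.orient o).E y x := by
  cases o <;> rfl

/-- The two infinite chains as one family: `ω` for `o = true`, its dual for `o = false`. -/
def chain (o : Bool) : Tournament.{0} :=
  chainOmega.orient o

instance (o : Bool) : Infinite (chain o).V :=
  inferInstanceAs (Infinite ℕ)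

theorem mem_frakB_iff {B : Tournament.{0}} : B ∈ frakB ↔ ∃ o, B ∈ frakBOf (chain o) :=
  or_comm.trans (Bool.exists_bool (p := fun o => B ∈ frakBOf (chain o))).symm

theorem exists_interlaced (o : Bool) :
    ∃ s : Fin 2 → ℕ → ℕ, (∀ i n, 0 < s i n) ∧
      (∀ (i j : Fin 2) (n m : ℕ), (chain o).E n m → (chain o).E (s i n) (s j m)) ∧
      ∀ n, (chain o).E (s 0 n) (s 1 n) := by
  cases o
  · refine ⟨fun i n => 2 * n + 2 - i, fun i n => ?_, fun i j n m (h : m < n) => ?_,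
      fun n => Nat.lt_succ_self (2 * n + 1)⟩
    · dsimp only
      omega
    · change 2 * m + 2 - j < 2 * n + 2 - i.val
      omega
  · refine ⟨fun i n => 2 * n + 1 + i, fun i n => ?_, fun i j n m (h : n < m) => ?_,
      fun n => Nat.lt_succ_self (2 * n + 1)⟩
    · dsimp only
      omega
    · change 2 * n + 1 + i < 2 * m + 1 + j.val
      omega

/-- The edges between a term of `p` and a later term of `q` all go forward (`o = true`), or all go
backward (`o = false`). -/
def Oriented (T : Tournament.{u}) (o : Bool) (p q : ℕ → T.V) : Prop :=
  ∀ i j, i < j → (T.orient o).E (p i) (q j)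

/-- The edges between the terms of `p` and those of `q` with another index follow the order of
`chain o`. -/
def Interleaved (T : Tournament.{u}) (o : Bool) (p q : ℕ → T.V) : Prop :=
  T.Oriented o p q ∧ T.Oriented o q p

section Oriented

variable {T : Tournament.{u}} {o o' : Bool} {p q : ℕ → T.V}

theorem Oriented.ne (h : T.Oriented o p p) {i j : ℕ} (hij : i < j) : p i ≠ p j :=
  (T.orient o).ne_of_edge (h i j hij)

theorem Oriented.unique (h : T.Oriented o p q) (h' : T.Oriented o' p q) : o = o' := by
  by_contra hne
  obtain rfl := Bool.eq_not_of_ne hne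
  exact (T.orient o').asymm _ _ (h' 0 1 one_pos) (orient_not_edge_iff.1 (h 0 1 one_pos))

theorem Oriented.edge_of_ne (h : T.Oriented o p q) (h' : T.Oriented (!o) q p) {i j : ℕ}
    (hij : i ≠ j) : (T.orient o).E (p i) (q j) := by
  rcases lt_or_gt_of_ne hij with hlt | hgt
  · exact h i j hlt
  · exact orient_not_edge_iff.1 (h' j i hgt)

theorem Interleaved.symm (h : T.Interleaved o p q) : T.Interleaved o q p :=
  And.symm h

theorem Interleaved.edge (h : T.Interleaved o p q) {i j : ℕ} (e : (chain o).E i j) :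
    T.E (p i) (q j) := by
  cases o
  · exact h.2 j i e
  · exact h.1 i j e

theorem Interleaved.edge_of_not (h : T.Interleaved (!o) p q) {i j : ℕ} (e : (chain o).E i j) :
    T.E (q j) (p i) :=
  h.symm.edge (orient_not_edge_iff.2 e)

end Oriented

/-! ### Tournaments in which no obstruction embeds -/

/-- No member of `𝔅` embeds in `T`. -/
def AvoidsObstructions (T : Tournament.{u}) : Prop :=
  ∀ B ∈ frakB, ¬ B.Embeds T

namespace AvoidsObstructions

variable {T : Tournament.{u}} {p q r : ℕ → T.V} {o o₁ o₂ : Bool}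

theorem not_embeds (hT : T.AvoidsObstructions) {B : Tournament.{0}} (o : Bool)
    (hB : B ∈ frakBOf (chain o)) : ¬ B.Embeds T :=
  hT B (mem_frakB_iff.2 ⟨o, hB⟩)

theorem not_forall_cycle (hT : T.AvoidsObstructions) (g : Fin 3 → ℕ → T.V)
    (hg : ∀ i j, T.Oriented o (g i) (g j)) : ¬ ∀ i n, T.E (g i n) (g (i + 1) n) := fun h =>
  hT.not_embeds o (by simp [frakBOf]) <|
    C3_embeds (C := chain o) g (fun i j _ _ e => Interleaved.edge ⟨hg i j, hg j i⟩ e) h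

theorem exists_not_edge_or_not_edge (hT : T.AvoidsObstructions) (hp : T.Oriented o p p)
    (hq : T.Oriented o q q) (hpq : T.Interleaved o p q) (a : T.V) :
    ∃ n, 0 < n ∧ ¬ (T.E a (p n) ∧ T.E (q n) a) := by
  by_contra! h
  obtain ⟨s, hpos, hs, hrow⟩ := exists_interlaced o
  refine hT.not_embeds o (by simp [frakBOf]) <| VT_embeds (C := chain o) a
    ![p ∘ s 0, q ∘ s 1] ?_ (fun n => hpq.edge (hrow n)) (fun n => (h _ (hpos 0 n)).1)
    (fun n => (h _ (hpos 1 n)).2)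
  simp only [Fin.forall_fin_two]
  exact ⟨⟨fun x y e => Interleaved.edge ⟨hp, hp⟩ (hs 0 0 x y e),
      fun x y e => hpq.edge (hs 0 1 x y e)⟩,
    ⟨fun x y e => hpq.symm.edge (hs 1 0 x y e),
      fun x y e => Interleaved.edge ⟨hq, hq⟩ (hs 1 1 x y e)⟩⟩

theorem oriented_unique (hT : T.AvoidsObstructions) (hp : T.Oriented o p p)
    (hq : T.Oriented o q q) (hpq : T.Interleaved o p q) (h₁ : T.Oriented o₁ r p)
    (h₂ : T.Oriented o₂ r q) : o₁ = o₂ := by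
  cases o₁ <;> cases o₂ <;> try rfl
  · obtain ⟨n, hn, h⟩ := hT.exists_not_edge_or_not_edge hq hp hpq.symm (r 0)
    exact absurd ⟨h₂ 0 n hn, h₁ 0 n hn⟩ h
  · obtain ⟨n, hn, h⟩ := hT.exists_not_edge_or_not_edge hp hq hpq (r 0)
    exact absurd ⟨h₁ 0 n hn, h₂ 0 n hn⟩ h

theorem oriented_self (hT : T.AvoidsObstructions) (hpq : T.Interleaved o p q)
    (hp : T.Oriented o₁ p p) (hq : T.Oriented o₂ q q) : T.Oriented o p p := by
  by_contra hne
  obtain ⟨s, -, hs, hrow⟩ := exists_interlaced o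
  obtain rfl : o₁ = !o := Bool.eq_not_of_ne (by rintro rfl; exact hne hp)
  obtain rfl | rfl := Bool.eq_or_eq_not o₂ o
  · exact hT.not_embeds o₂ (by simp [frakBOf]) <|
      UT_embeds (C := chain o₂) (p := q ∘ s 0) (q := p ∘ s 1)
        (fun x y e => Interleaved.edge ⟨hq, hq⟩ (hs 0 0 x y e))
        (fun x y e => hpq.symm.edge (hs 0 1 x y e)) (fun x y e => hpq.edge (hs 1 0 x y e))
        (fun x y e => Interleaved.edge_of_not ⟨hp, hp⟩ (hs 1 1 x y e))
        (fun x => hpq.symm.edge (hrow x))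
  · have hs' (i j : Fin 2) (x y : ℕ) (e : (chain !o).E x y) : (chain o).E (s j y) (s i x) :=
      hs j i y x (orient_not_edge_iff.1 e)
    exact hT.not_embeds (!o) (by simp [frakBOf]) <|
      TT_embeds (C := chain !o) (p := p ∘ s 0) (q := q ∘ s 1)
        (fun x y e => Interleaved.edge_of_not ⟨hp, hp⟩ (hs' 0 0 x y e))
        (fun x y e => hpq.symm.edge (hs' 0 1 x y e)) (fun x y e => hpq.edge (hs' 1 0 x y e))
        (fun x y e => Interleaved.edge_of_not ⟨hq, hq⟩ (hs' 1 1 x y e))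
        (fun x => hpq.edge (hrow x))

theorem not_forall_edge (hT : T.AvoidsObstructions) (hp : T.Oriented o₁ p p)
    (hq : T.Oriented o₂ q q) (hpq : ∀ i j, i ≠ j → T.E (p i) (q j)) :
    ¬ ∀ n, T.E (q n) (p n) := by
  intro h
  have hqq : ∀ x y : ℕ, (chain o₂).E x y → T.E (q x) (q y) := fun x y e =>
    Interleaved.edge ⟨hq, hq⟩ e
  obtain rfl | rfl := Bool.eq_or_eq_not o₁ o₂
  · exact hT.not_embeds o₁ (by simp [frakBOf]) <| HT_embeds (C := chain o₁) hqq hpq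
      (fun x y e => Interleaved.edge ⟨hp, hp⟩ e) h
  · exact hT.not_embeds o₂ (by simp [frakBOf]) <| KT_embeds (C := chain o₂) hqq hpq
      (fun x y e => Interleaved.edge_of_not ⟨hp, hp⟩ e) h

end AvoidsObstructions

/-! ### Homogeneous arrays -/

theorem exists_strictMono_forall_lt_eq {κ : Type*} [Finite κ] (c : ℕ → ℕ → κ) :
    ∃ φ : ℕ → ℕ, StrictMono φ ∧ ∃ k, ∀ i j, i < j → c (φ i) (φ j) = k := by
  have exists_eventually_eq (d : ℕ → κ) : ∃ k, ∀ᶠ j in (Filter.hyperfilter ℕ : Filter ℕ), d j = k :=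
    (Ultrafilter.eventually_exists_iff (P := fun k j => d j = k)).1
      (Filter.Eventually.of_forall fun j => ⟨d j, rfl⟩)
  choose d hd using fun i => exists_eventually_eq (c i)
  obtain ⟨k, hk⟩ := exists_eventually_eq d
  obtain ⟨φ, -, hφ⟩ := exists_seq_of_forall_finset_exists (fun i => d i = k)
    (fun i j => i < j ∧ c i j = k) fun s hs => by
      have later : ∀ᶠ j in (Filter.hyperfilter ℕ : Filter ℕ), ∀ x ∈ s, x < j ∧ c x j = k := by
        rw [Filter.eventually_all_finset]
        intro x hx
        have hgt : ∀ᶠ j in (Filter.hyperfilter ℕ : Filter ℕ), x < j :=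
          Nat.hyperfilter_le_atTop (Filter.eventually_gt_atTop x)
        exact hgt.and (hs x hx ▸ hd x)
      exact (hk.and later).exists
  exact ⟨φ, fun i j h => (hφ i j h).1, k, fun i j h => (hφ i j h).2⟩

/-- The edges and the equalities inside a row of the array `f`, and those between two of its rows,
do not depend on the choice of the rows. -/
structure Homogeneous (T : Tournament.{u}) {κ : Type v} (f : ℕ → κ → T.V) : Prop where
  edge_iff : ∀ o a b i j k l, i < j → k < l →
    ((T.orient o).E (f i a) (f j b) ↔ (T.orient o).E (f k a) (f l b))
  row_edge_iff : ∀ a b i k, T.E (f i a) (f i b) ↔ T.E (f k a) (f k b)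

theorem exists_homogeneous (T : Tournament.{u}) {κ : Type v} [Finite κ] (f : ℕ → κ → T.V) :
    ∃ φ : ℕ → ℕ, StrictMono φ ∧ T.Homogeneous (f ∘ φ) := by
  obtain ⟨φ, hφ, k, hk⟩ := exists_strictMono_forall_lt_eq (κ := Bool → κ → κ → Prop × Prop)
    fun i j o a b => ((T.orient o).E (f i a) (f j b), T.E (f i a) (f i b))
  have eq_of_lt {i j i' j' : ℕ} (h : i < j) (h' : i' < j') (o : Bool) (a b : κ) :=
    congrFun (congrFun (congrFun ((hk i j h).trans (hk i' j' h').symm) o) a) b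
  exact ⟨φ, hφ, fun o a b i j k l hij hkl => iff_of_eq (congrArg Prod.fst (eq_of_lt hij hkl o a b)),
    fun a b i k => iff_of_eq (congrArg Prod.snd
      (eq_of_lt (Nat.lt_succ_self i) (Nat.lt_succ_self k) true a b))⟩

namespace Homogeneous

variable {T : Tournament.{u}} {κ : Type v} {f : ℕ → κ → T.V} {a b c s x y : κ} {o : Bool}

theorem oriented_or_eq (hf : T.Homogeneous f) (a b : κ) :
    (∃ o, T.Oriented o (f · a) (f · b)) ∨ ∀ i j, i < j → f i a = f j b := by
  by_cases h : ∃ o, (T.orient o).E (f 0 a) (f 1 b)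
  · obtain ⟨o, h⟩ := h
    exact Or.inl ⟨o, fun i j hij => (hf.edge_iff o a b 0 1 i j one_pos hij).1 h⟩
  · refine Or.inr fun i j hij => eq_iff_not_edge.2 ⟨fun e => h ⟨true, ?_⟩, fun e => h ⟨false, ?_⟩⟩
    · exact (hf.edge_iff true a b i j 0 1 hij one_pos).1 e
    · exact (hf.edge_iff false a b i j 0 1 hij one_pos).1 e

theorem exists_oriented_left (hf : T.Homogeneous f) (ha : T.Oriented o (f · a) (f · a)) (b : κ) :
    ∃ o', T.Oriented o' (f · a) (f · b) :=
  (hf.oriented_or_eq a b).resolve_right fun h =>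
    ha.ne one_pos ((h 0 2 two_pos).trans (h 1 2 one_lt_two).symm)

theorem exists_oriented_right (hf : T.Homogeneous f) (ha : T.Oriented o (f · a) (f · a)) (b : κ) :
    ∃ o', T.Oriented o' (f · b) (f · a) :=
  (hf.oriented_or_eq b a).resolve_right fun h =>
    ha.ne one_lt_two ((h 0 1 one_pos).symm.trans (h 0 2 two_pos))

theorem exists_oriented_self (hf : T.Homogeneous f)
    (hab : T.Interleaved o (f · a) (f · b)) : ∃ o', T.Oriented o' (f · a) (f · a) := by
  refine (hf.oriented_or_eq a a).resolve_right fun h => ?_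
  have h02 : (T.orient o).E (f 1 b) (f 0 a) := (h 0 2 two_pos) ▸ hab.2 1 2 one_lt_two
  exact (T.orient o).asymm _ _ (hab.1 0 1 one_pos) h02

theorem row_eq_iff (hf : T.Homogeneous f) (i k : ℕ) : f i a = f i b ↔ f k a = f k b := by
  rw [eq_iff_not_edge, hf.row_edge_iff a b i k, hf.row_edge_iff b a i k, ← eq_iff_not_edge]

theorem oriented_self (hf : T.Homogeneous f) (hT : T.AvoidsObstructions)
    (hab : T.Interleaved o (f · a) (f · b)) : T.Oriented o (f · a) (f · a) := by
  obtain ⟨o₁, ha⟩ := hf.exists_oriented_self hab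
  obtain ⟨o₂, hb⟩ := hf.exists_oriented_self hab.symm
  exact hT.oriented_self hab ha hb

theorem oriented_of_interleaved (hf : T.Homogeneous f) (hT : T.AvoidsObstructions)
    (hab : T.Interleaved o (f · a) (f · b)) (hac : T.Interleaved o (f · a) (f · c)) :
    T.Oriented o (f · b) (f · c) := by
  have hc := hf.oriented_self hT hac.symm
  obtain ⟨o', hbc⟩ := hf.exists_oriented_right hc b
  rwa [hT.oriented_unique (hf.oriented_self hT hab) hc hac hab.2 hbc]

theorem edge_of_not_interleaved (hf : T.Homogeneous f) (hT : T.AvoidsObstructions)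
    (ha : T.Oriented o (f · a) (f · a)) (h : ¬ T.Interleaved o (f · a) (f · s)) :
    ∃ o', T.Oriented o' (f · s) (f · a) ∧ ∀ i j, i ≠ j → (T.orient o').E (f i s) (f j a) := by
  obtain ⟨o₁, has⟩ := hf.exists_oriented_left ha s
  obtain ⟨o₂, hsa⟩ := hf.exists_oriented_right ha s
  suffices hne : o₁ ≠ o₂ by
    obtain rfl := Bool.eq_not_of_ne hne
    exact ⟨o₂, hsa, fun i j => hsa.edge_of_ne has⟩
  rintro rfl
  obtain rfl := (hf.oriented_self hT ⟨has, hsa⟩).unique ha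
  exact h ⟨has, hsa⟩

theorem row_edge (hf : T.Homogeneous f) (hT : T.AvoidsObstructions)
    (h : ∀ i j, i ≠ j → T.E (f i a) (f j b)) (n : ℕ) : T.E (f n a) (f n b) := by
  rcases hf.oriented_or_eq a a with ⟨o₁, ha⟩ | ha
  swap
  · rw [ha n (n + 1) n.lt_succ_self]
    exact h _ _ n.succ_ne_self
  rcases hf.oriented_or_eq b b with ⟨o₂, hb⟩ | hb
  swap
  · rw [hb n (n + 1) n.lt_succ_self]
    exact h _ _ n.succ_ne_self.symm
  have not_edge : ¬ T.E (f n b) (f n a) := fun e =>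
    hT.not_forall_edge ha hb h fun k => (hf.row_edge_iff b a n k).1 e
  have hne : f n a ≠ f n b := fun e => by
    have e' : f (n + 1) a = f (n + 1) b := (hf.row_eq_iff n (n + 1)).1 e
    exact T.asymm _ _ (h n (n + 1) n.succ_ne_self.symm) (e ▸ e' ▸ h (n + 1) n n.succ_ne_self)
  exact edge_of_not_edge hne.symm not_edge

theorem row_edge_orient (hf : T.Homogeneous f) (hT : T.AvoidsObstructions)
    (h : ∀ i j, i ≠ j → (T.orient o).E (f i a) (f j b)) (n : ℕ) :
    (T.orient o).E (f n a) (f n b) := by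
  cases o
  · exact hf.row_edge hT (fun i j hij => h j i hij.symm) n
  · exact hf.row_edge hT h n

theorem relatedIn (hf : T.Homogeneous f) (hT : T.AvoidsObstructions)
    (hxy : T.Interleaved o (f · x) (f · y)) (n : ℕ) :
    T.RelatedIn (Set.range (f n)) (f n x) (f n y) := by
  have hx : T.Oriented o (f · x) (f · x) := hf.oriented_self hT hxy
  -- the columns interleaved with the column `x` are pairwise interleaved
  let M : Set κ := {a | T.Interleaved o (f · x) (f · a)}
  have hM : ∀ a ∈ M, ∀ b ∈ M, T.Oriented o (f · a) (f · b) := fun a ha b hb =>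
    hf.oriented_of_interleaved hT ha hb
  refine ⟨f n '' M, ⟨Set.image_subset_range _ _, ?_, ?_⟩, ⟨x, ⟨hx, hx⟩, rfl⟩, ⟨y, hxy, rfl⟩⟩
  · rintro _ ⟨a, ha, rfl⟩ _ ⟨b, hb, rfl⟩ _ ⟨c, hc, rfl⟩ ⟨hab, hbc, hca⟩
    have hcol : ∀ i : Fin 3, ![a, b, c] i ∈ M := by
      simp [Fin.forall_fin_succ, ha, hb, hc]
    refine hT.not_forall_cycle (fun i k => f k (![a, b, c] i))
      (fun i j => hM _ (hcol i) _ (hcol j)) fun i k => (hf.row_edge_iff _ _ n k).1 ?_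
    fin_cases i <;> assumption
  · rintro _ ⟨a, ha, rfl⟩ _ ⟨b, hb, rfl⟩ _ ⟨s, rfl⟩ hsM has
    have hs : ∀ c ∈ M, ¬ T.Interleaved o (f · c) (f · s) := fun c hc hcs => hsM
      ⟨s, ⟨hf.oriented_of_interleaved hT hc.symm hcs,
        (hf.oriented_of_interleaved hT hcs hc.symm)⟩, rfl⟩
    obtain ⟨o₁, hsa, h₁⟩ := hf.edge_of_not_interleaved hT (hM a ha a ha) (hs a ha)
    obtain ⟨o₂, hsb, h₂⟩ := hf.edge_of_not_interleaved hT (hM b hb b hb) (hs b hb)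
    obtain rfl := hT.oriented_unique (hM a ha a ha) (hM b hb b hb)
      ⟨hM a ha b hb, hM b hb a ha⟩ hsa hsb
    cases o₁
    · exact hf.row_edge_orient hT h₂ n
    · exact absurd (hf.row_edge_orient hT h₁ n) (T.asymm _ _ has)

end Homogeneous

theorem exists_oriented_comp {T : Tournament.{u}} {g : ℕ → T.V} (hg : Function.Injective g) :
    ∃ φ : ℕ → ℕ, StrictMono φ ∧ ∃ o, T.Oriented o (g ∘ φ) (g ∘ φ) := by
  obtain ⟨φ, hφ, hf⟩ := T.exists_homogeneous fun n (_ : Unit) => g n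
  refine ⟨φ, hφ, (hf.oriented_or_eq () ()).resolve_right fun h => ?_⟩
  exact zero_ne_one (hφ.injective (hg (h 0 1 one_pos)))

namespace AvoidsObstructions

theorem finite_quotient {T : Tournament.{u}} (hT : T.AvoidsObstructions) :
    Finite (Quotient T.acyclicSetoid) := by
  by_contra hinf
  rw [not_finite_iff_infinite] at hinf
  let q := Infinite.natEmbedding (Quotient T.acyclicSetoid)
  obtain ⟨φ, hφ, o, hg⟩ := exists_oriented_comp (Quotient.out_injective.comp q.injective)
  set g : ℕ → T.V := (Quotient.out ∘ q) ∘ φ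
  have unrelated (n : ℕ) : ¬ T.acyclicSetoid (g (2 * n)) (g (2 * n + 1)) := fun h => by
    have := hφ.injective (q.injective (Quotient.out_equiv_out.1 h))
    omega
  choose u v w huvw using fun n => exists_fin_five_not_relatedIn (unrelated n)
  let f : ℕ → Fin 5 → T.V := fun n => ![g (2 * n), g (2 * n + 1), u n, v n, w n]
  obtain ⟨ψ, hψ, hf⟩ := T.exists_homogeneous f
  have interleaved : T.Interleaved o (fun n => f (ψ n) 0) (fun n => f (ψ n) 1) :=
    ⟨fun i j hij => hg _ _ (by have := hψ hij; omega),
      fun i j hij => hg _ _ (by have := hψ hij; omega)⟩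
  exact huvw (ψ 0) (hf.relatedIn hT interleaved 0)

end AvoidsObstructions

/-! ### The obstructions are not finite sums of acyclic tournaments -/

section NotFiniteSum

variable (C : Tournament.{u}) [Infinite C.V]

theorem not_isFiniteSumOfAcyclic_C3 : ¬ C.C3.IsFiniteSumOfAcyclic := by
  refine not_isFiniteSumOfAcyclic_of_forall_edge (C := C) (fun x => ⟨x, (0 : Fin 3)⟩) ?_
  rintro x y hxy ⟨M, hM, hx, hy⟩
  have edge (i : Fin 3) : C.C3.E ⟨x, i⟩ ⟨x, i + 1⟩ := Sigma.Lex.right _ _ rfl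
  have h1 := hM.mem_of_between hx hy (Set.mem_univ _) (edge 0) (Sigma.Lex.left _ _ hxy)
  exact hM.not_cycle_of_mem hx h1 (Set.mem_univ _) ⟨edge 0, edge 1, edge 2⟩

theorem not_isFiniteSumOfAcyclic_VT : ¬ C.VT.IsFiniteSumOfAcyclic := by
  refine not_isFiniteSumOfAcyclic_of_forall_edge (C := C) (fun x => some (x, 0)) ?_
  rintro x y hxy ⟨M, hM, hx, hy⟩
  have hrow : C.VT.E (some (x, 0)) (some (x, 1)) := Or.inr ⟨rfl, Fin.zero_lt_one⟩
  have h1 := hM.mem_of_between hx hy (Set.mem_univ _) hrow (Or.inl hxy)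
  have cycle : C.VT.Cycle (some (x, 0)) (some (x, 1)) none := ⟨hrow, rfl, rfl⟩
  exact hM.not_cycle_of_mem hx h1 (Set.mem_univ _) cycle

variable {X : Finset Pair2} (hX : Good X)

theorem not_isFiniteSumOfAcyclic_Delta_of_swap_dp_mem (hv : vp 0 ∈ X) (hh : hp 0 ∈ X)
    (hd : (dp 0).swap ∈ X) : ¬ (C.Delta X hX).IsFiniteSumOfAcyclic := by
  refine not_isFiniteSumOfAcyclic_of_forall_edge (C := C) (fun x => (x, (0 : Fin 2))) ?_
  rintro x y hxy ⟨M, hM, hx, hy⟩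
  have cycle : (C.Delta X hX).Cycle (x, (0 : Fin 2)) (y, (0 : Fin 2)) (y, (1 : Fin 2)) :=
    ⟨Or.inr (Or.inl ⟨hxy, hh⟩), Or.inl ⟨rfl, hv⟩, Or.inr (Or.inr ⟨hxy, hd⟩)⟩
  exact hM.not_cycle_of_mem hx hy (Set.mem_univ _) cycle

theorem not_isFiniteSumOfAcyclic_Delta_of_swap_hp_mem (hv : vp 0 ∈ X) (hd : dp 1 ∈ X)
    (hh : (hp 1).swap ∈ X) : ¬ (C.Delta X hX).IsFiniteSumOfAcyclic := by
  refine not_isFiniteSumOfAcyclic_of_forall_edge (C := C) (fun x => (x, (1 : Fin 2))) ?_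
  rintro x y hxy ⟨M, hM, hx, hy⟩
  have cycle : (C.Delta X hX).Cycle (y, (1 : Fin 2)) (x, (1 : Fin 2)) (y, (0 : Fin 2)) :=
    ⟨Or.inr (Or.inr ⟨hxy, hh⟩), Or.inr (Or.inl ⟨hxy, hd⟩), Or.inl ⟨rfl, hv⟩⟩
  exact hM.not_cycle_of_mem hy hx (Set.mem_univ _) cycle

theorem not_isFiniteSumOfAcyclic_of_mem_frakBOf {B : Tournament.{u}} (hB : B ∈ frakBOf C) :
    ¬ B.IsFiniteSumOfAcyclic := by
  rcases hB with rfl | rfl | rfl | rfl | rfl | rfl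
  · exact not_isFiniteSumOfAcyclic_C3 C
  · exact not_isFiniteSumOfAcyclic_VT C
  · exact not_isFiniteSumOfAcyclic_Delta_of_swap_dp_mem C _ (by decide) (by decide) (by decide)
  · exact not_isFiniteSumOfAcyclic_Delta_of_swap_hp_mem C _ (by decide) (by decide) (by decide)
  · exact not_isFiniteSumOfAcyclic_Delta_of_swap_dp_mem C _ (by decide) (by decide) (by decide)
  · exact not_isFiniteSumOfAcyclic_Delta_of_swap_dp_mem C _ (by decide) (by decide) (by decide)

end NotFiniteSum

/-! ### The obstruction set -/

theorem isObstructionSet_frakB : IsObstructionSet.{u, 0} frakB := by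
  have not_sum : ∀ B ∈ frakB, ¬ B.IsFiniteSumOfAcyclic := by
    intro B hB
    obtain ⟨o, hB⟩ := mem_frakB_iff.1 hB
    exact not_isFiniteSumOfAcyclic_of_mem_frakBOf _ hB
  refine ⟨not_sum, fun T => ⟨fun hT B hB h => not_sum B hB (hT.of_embeds h), fun hT => ?_⟩⟩
  exact isFiniteSumOfAcyclic_iff_finite_quotient.2 (AvoidsObstructions.finite_quotient hT)

theorem IsObstructionSet.exists_embeds {S : Set Tournament.{v}} (hS : IsObstructionSet.{u, v} S)
    {T : Tournament.{u}} (hT : ¬ T.IsFiniteSumOfAcyclic) : ∃ A ∈ S, A.Embeds T := by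
  by_contra! h
  exact hT ((hS.2 T).2 h)

theorem IsObstructionSet.encard_le_encard {𝓑 : Set Tournament.{w}} {S : Set Tournament.{v}}
    (h𝓑 : IsObstructionSet.{v, w} 𝓑)
    (antichain : ∀ B ∈ 𝓑, ∀ B' ∈ 𝓑, B.Embeds B' → B = B')
    (hS : IsObstructionSet.{max u w, v} S) : 𝓑.encard ≤ S.encard := by
  have exists_embeds : ∀ B : 𝓑, ∃ A ∈ S, A.Embeds B.1 := by
    intro B
    let B' : Tournament.{max u w} :=
      B.1.comap (ULift.down : ULift.{u} B.1.V → B.1.V) ULift.down_injective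
    have hB' : B.1.Embeds B' := .of_map_edge ULift.up fun _ _ h => h
    obtain ⟨A, hA, h⟩ := hS.exists_embeds fun h => h𝓑.1 _ B.2 (h.of_embeds hB')
    exact ⟨A, hA, h.trans (.of_map_edge ULift.down fun _ _ h => h)⟩
  choose s hsS hs using exists_embeds
  -- `s` is injective, because some member of `𝓑` embeds in `s B`, and it can only be `B`
  have eq_of_embeds (A : Tournament.{w}) (hA : A ∈ 𝓑) (B : 𝓑) (h : A.Embeds (s B)) : A = B.1 :=
    antichain A hA B.1 B.2 (h.trans (hs B))
  refine ENat.card_le_card_of_injective (f := fun B : 𝓑 => (⟨s B, hsS B⟩ : S)) fun B B' h => ?_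
  have hss : s B = s B' := congrArg Subtype.val h
  obtain ⟨A, hA, hAB⟩ := h𝓑.exists_embeds (hS.1 _ (hsS B))
  exact Subtype.ext ((eq_of_embeds A hA B hAB).symm.trans (eq_of_embeds A hA B' (hss ▸ hAB)))

/-! ### Embeddings between tournaments with periodic edges -/

/-- The rows `β n` contain all but finitely many vertices of `B`, and the direction of an edge from
one row to a later one depends only on the two columns: it is given by the pattern `F`. Each of the
twelve obstructions has such a description, with two or three columns. -/
structure IsArray (B : Tournament.{u}) {κ : Type*} (β : ℕ → κ → B.V) (F : κ → κ → Prop) :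
    Prop where
  edge_iff : ∀ {i j n m}, n < m → (B.E (β n i) (β m j) ↔ F i j)
  finite_compl_range : (Set.range fun x : ℕ × κ => β x.1 x.2)ᶜ.Finite
  injective : ∀ i, Function.Injective fun n => β n i

namespace IsArray

variable {B : Tournament.{u}} {B' : Tournament.{v}} {κ κ' : Type*} {β : ℕ → κ → B.V}
  {β' : ℕ → κ' → B'.V} {F : κ → κ → Prop} {F' : κ' → κ' → Prop}

theorem eventually_exists_eq [Finite κ] (h : B.IsArray β F) {f : ℕ → B.V}
    (hf : Function.Injective f) (N : ℕ) : ∀ᶠ n in Filter.cofinite, ∃ m > N, ∃ i, f n = β m i := by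
  have early : ((fun x : ℕ × κ => β x.1 x.2) '' Set.Iic N ×ˢ Set.univ).Finite :=
    ((Set.finite_Iic N).prod Set.finite_univ).image _
  refine ((h.finite_compl_range.union early).preimage hf.injOn).subset fun n hn => ?_
  refine or_iff_not_imp_left.2 fun hc => ?_
  obtain ⟨⟨m, i⟩, hm⟩ := not_not.1 hc
  exact ⟨(m, i), ⟨not_lt.1 fun hNm => hn ⟨m, hNm, i, hm.symm⟩, trivial⟩, hm⟩

theorem exists_columns [Finite κ] [Finite κ'] (h : B.IsArray β F) (h' : B'.IsArray β' F')
    (g : B.E ↪r B'.E) :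
    ∃ c : κ → κ', ∀ N, ∃ n > N, ∃ r : κ → ℕ, ∀ i, N < r i ∧ g (β n i) = β' (r i) (c i) := by
  have exists_row (N : ℕ) : ∃ n > N, ∀ i, ∃ m > N, ∃ j, g (β n i) = β' m j := by
    have hev : ∀ᶠ n in Filter.atTop, ∀ i, ∃ m > N, ∃ j, g (β n i) = β' m j := by
      rw [← Nat.cofinite_eq_atTop, Filter.eventually_all]
      exact fun i => h'.eventually_exists_eq (g.injective.comp (h.injective i)) N
    exact ((Filter.eventually_gt_atTop N).and hev).exists
  choose n hn r hr c hc using exists_row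
  obtain ⟨γ, hγ⟩ := Finite.exists_infinite_fiber c
  refine ⟨γ, fun N => ?_⟩
  obtain ⟨M, rfl, hNM⟩ := (Set.infinite_coe_iff.1 hγ).exists_gt N
  exact ⟨n M, hNM.trans (hn M), r M, fun i => ⟨hNM.trans (hr M i), hc M i⟩⟩

theorem exists_column_map [Finite κ] [Finite κ'] (h : B.IsArray β F) (h' : B'.IsArray β' F')
    (g : B.E ↪r B'.E) :
    ∃ c : κ → κ', (∀ i j, F' (c i) (c j) ↔ F i j) ∧
      ∀ N, ∃ n > N, ∃ r : κ → ℕ, ∀ i, N < r i ∧ g (β n i) = β' (r i) (c i) := by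
  obtain ⟨c, hc⟩ := h.exists_columns h' g
  refine ⟨c, fun i j => ?_, hc⟩
  obtain ⟨n, -, r, hr⟩ := hc 0
  obtain ⟨n', hn', r', hr'⟩ := hc (max n (r i))
  rw [← h.edge_iff ((le_max_left _ _).trans_lt hn'), ← g.map_rel_iff, (hr i).2, (hr' j).2,
    h'.edge_iff ((le_max_right _ _).trans_lt (hr' j).1)]

theorem lt_of_edge (h : B.IsArray β F) {k : κ} {n m : ℕ} (e : B.E (β n k) (β m k)) :
    (n < m ∧ F k k) ∨ (m < n ∧ ¬ F k k) := by
  rcases lt_trichotomy n m with hlt | rfl | hgt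
  · exact Or.inl ⟨hlt, (h.edge_iff hlt).1 e⟩
  · exact (B.irrefl _ e).elim
  · exact Or.inr ⟨hgt, fun hF => B.asymm _ _ e ((h.edge_iff hgt).2 hF)⟩

theorem not_cycle (h : B.IsArray β F) (k : κ) (n m l : ℕ) :
    ¬ B.Cycle (β n k) (β m k) (β l k) := by
  rintro ⟨h1, h2, h3⟩
  rcases h.lt_of_edge h1 with ⟨h1, hF⟩ | ⟨h1, hF⟩
  · have h2 := (h.lt_of_edge h2).resolve_right fun h2 => h2.2 hF
    have h3 := (h.lt_of_edge h3).resolve_right fun h3 => h3.2 hF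
    exact lt_asymm (h1.trans h2.1) h3.1
  · have h2 := (h.lt_of_edge h2).resolve_left fun h2 => hF h2.2
    have h3 := (h.lt_of_edge h3).resolve_left fun h3 => hF h3.2
    exact lt_asymm (h2.1.trans h1) h3.1

end IsArray

/-! ### The obstructions do not embed in each other -/

theorem chain_edge_iff_of_lt {o : Bool} {n m : ℕ} (h : n < m) :
    (chain o).E n m ↔ o = true := by
  cases o
  · exact iff_of_false (lt_asymm h) Bool.false_ne_true
  · exact iff_of_true h rfl

theorem chain_edge_iff_of_gt {o : Bool} {n m : ℕ} (h : n < m) :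
    (chain o).E m n ↔ o = false := by
  cases o
  · exact iff_of_true h rfl
  · exact iff_of_false (lt_asymm h) Bool.true_eq_false_eq_False

/-- The pattern of `Δ(C, X)`, for `C = chain o`. -/
def deltaPattern (o : Bool) (X : Finset Pair2) (i j : Fin 2) : Prop :=
  (if o then ((0, i), (1, j)) else ((1, i), (0, j))) ∈ X

instance (o : Bool) (X : Finset Pair2) (i j : Fin 2) : Decidable (deltaPattern o X i j) :=
  inferInstanceAs (Decidable (_ ∈ X))

theorem isArray_C3 (o : Bool) :
    (chain o).C3.IsArray (fun n (i : Fin 3) => ⟨n, i⟩) (fun _ _ => o = true) where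
  edge_iff h := (lexSum_edge_iff_of_ne (F := fun _ => cycle3) h.ne).trans (chain_edge_iff_of_lt h)
  finite_compl_range := Set.finite_empty.subset fun v h => h ⟨(v.1, v.2), rfl⟩
  injective _ _ _ h := congrArg Sigma.fst h

theorem isArray_VT (o : Bool) :
    (chain o).VT.IsArray (fun n (i : Fin 2) => some (n, i)) (fun _ _ => o = true) where
  edge_iff h := (or_iff_left fun e => h.ne e.1).trans (chain_edge_iff_of_lt h)
  finite_compl_range := by
    refine (Set.finite_singleton none).subset ?_
    rintro (_ | ⟨n, i⟩) h
    · rfl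
    · exact (h ⟨(n, i), rfl⟩).elim
  injective _ _ _ h := congrArg Prod.fst (Option.some.inj h)

theorem isArray_Delta (o : Bool) {X : Finset Pair2} (hX : Good X) :
    ((chain o).Delta X hX).IsArray (fun n (i : Fin 2) => (n, i)) (deltaPattern o X) where
  edge_iff {i j n m} h := by
    change (n = m ∧ _ ∨ (chain o).E n m ∧ _ ∨ (chain o).E m n ∧ _) ↔ _
    rw [chain_edge_iff_of_lt h, chain_edge_iff_of_gt h]
    cases o <;> simp [deltaPattern, h.ne]
  finite_compl_range := Set.finite_empty.subset fun v h => h ⟨(v.1, v.2), rfl⟩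
  injective _ _ _ h := congrArg Prod.fst h

theorem acyclic_chain (o : Bool) : (chain o).Acyclic := by
  cases o
  · exact fun (x y z : ℕ) ⟨hxy, hyz, hzx⟩ => lt_asymm (hzx.trans hyz) (show y < x from hxy)
  · exact fun (x y z : ℕ) ⟨hxy, hyz, hzx⟩ => lt_asymm (hyz.trans hzx) (show x < y from hxy)

theorem Acyclic.not_cycle_VT_some {C : Tournament.{u}} (hC : C.Acyclic) (x y z : C.V × Fin 2) :
    ¬ C.VT.Cycle (some x) (some y) (some z) := by
  obtain ⟨x, i⟩ := x
  obtain ⟨y, j⟩ := y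
  obtain ⟨z, k⟩ := z
  rintro ⟨hxy | ⟨rfl, hij⟩, hyz | ⟨rfl, hjk⟩, hzx | ⟨hzx, hki⟩⟩
  · exact hC x y z ⟨hxy, hyz, hzx⟩
  · exact C.asymm _ _ hxy (hzx ▸ hyz)
  · exact C.asymm _ _ hxy hzx
  · exact ne_of_edge hxy hzx.symm
  · exact C.asymm _ _ hyz hzx
  · exact ne_of_edge hyz hzx.symm
  · exact C.irrefl _ hzx
  · exact lt_asymm (hij.trans hjk) hki

section EmbedsInArray

variable {B : Tournament.{u}} {κ : Type*} [Finite κ] {β : ℕ → κ → B.V} {F : κ → κ → Prop}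
  {o : Bool}

theorem IsArray.exists_cycle_of_C3_embeds (hB : B.IsArray β F) (h : (chain o).C3.Embeds B) :
    ∃ (c : Fin 3 → κ) (r : Fin 3 → ℕ), (∀ i j, F (c i) (c j) ↔ o = true) ∧
      B.Cycle (β (r 0) (c 0)) (β (r 1) (c 1)) (β (r 2) (c 2)) := by
  obtain ⟨g⟩ := h
  obtain ⟨c, hc, hg⟩ := (isArray_C3 o).exists_column_map hB g
  obtain ⟨n, -, r, hr⟩ := hg 0
  have edge (i : Fin 3) : B.E (β (r i) (c i)) (β (r (i + 1)) (c (i + 1))) := by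
    rw [← (hr i).2, ← (hr (i + 1)).2]
    exact g.map_rel_iff.2 (lexSum_edge_mk_iff.2 rfl)
  exact ⟨c, r, hc, edge 0, edge 1, edge 2⟩

theorem IsArray.exists_distinguished_of_VT_embeds (hB : B.IsArray β F)
    (hβ : ∀ v, ∃ n i, β n i = v) (h : (chain o).VT.Embeds B) :
    ∃ (c : Fin 2 → κ) (k : κ), (∀ i j, F (c i) (c j) ↔ o = true) ∧ F k (c 0) ∧ ¬ F k (c 1) := by
  obtain ⟨g⟩ := h
  obtain ⟨c, hc, hg⟩ := (isArray_VT o).exists_column_map hB g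
  obtain ⟨m, k, hk⟩ := hβ (g none)
  obtain ⟨n, -, r, hr⟩ := hg m
  have edge_iff (i : Fin 2) : F k (c i) ↔ (chain o).VT.E none (some (n, i)) := by
    rw [← hB.edge_iff (hr i).1, hk, ← (hr i).2]
    exact g.map_rel_iff
  exact ⟨c, k, hc, (edge_iff 0).2 rfl, fun h1 => one_ne_zero ((edge_iff 1).1 h1)⟩

end EmbedsInArray

/-- The four sets `X` defining `T_{[C]}`, `U_{[C]}`, `H_{[C]}` and `K_{[C]}`. -/
def edgeSet : Fin 4 → Finset Pair2 :=
  ![XT, XU, XH, XK]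

instance : DecidablePred Good := fun X => by
  unfold Good
  infer_instance

theorem good_edgeSet : ∀ i, Good (edgeSet i) := by
  decide

theorem eq_of_deltaPattern_iff : ∀ (o o' : Bool) (x : Fin 4) (i j : Fin 2),
    (∀ a ∈ [i, j], ∀ b ∈ [i, j], deltaPattern o' (edgeSet x) a b ↔ o = true) → i = j := by
  decide

theorem deltaPattern_injective : ∀ (o o' : Bool) (x x' : Fin 4) (c : Fin 2 → Fin 2),
    (∀ i j, deltaPattern o' (edgeSet x') (c i) (c j) ↔ deltaPattern o (edgeSet x) i j) →
      x = x' ∧ o = o' := by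
  decide

/-- The family of the members of `𝔅`: one for each of the six constructions and each `chain o`. -/
def obstruction : Option (Option (Fin 4)) × Bool → Tournament.{0}
  | (none, o) => (chain o).C3
  | (some none, o) => (chain o).VT
  | (some (some i), o) => (chain o).Delta (edgeSet i) (good_edgeSet i)

theorem frakB_eq_range : frakB = Set.range obstruction := by
  ext B
  rw [mem_frakB_iff]
  constructor
  · rintro ⟨o, rfl | rfl | rfl | rfl | rfl | rfl⟩
    exacts [⟨(none, o), rfl⟩, ⟨(some none, o), rfl⟩, ⟨(some (some 0), o), rfl⟩,
      ⟨(some (some 1), o), rfl⟩, ⟨(some (some 2), o), rfl⟩, ⟨(some (some 3), o), rfl⟩]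
  · rintro ⟨⟨_ | _ | i, o⟩, rfl⟩
    · exact ⟨o, Or.inl rfl⟩
    · exact ⟨o, Or.inr (Or.inl rfl)⟩
    · refine ⟨o, Or.inr (Or.inr ?_)⟩
      fin_cases i
      exacts [Or.inl rfl, Or.inr (Or.inl rfl), Or.inr (Or.inr (Or.inl rfl)),
        Or.inr (Or.inr (Or.inr rfl))]

theorem not_C3_embeds_VT (o o' : Bool) : ¬ (chain o).C3.Embeds (chain o').VT := fun h => by
  obtain ⟨c, r, -, hcycle⟩ := (isArray_VT o').exists_cycle_of_C3_embeds h
  exact (acyclic_chain o').not_cycle_VT_some _ _ _ hcycle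

theorem not_C3_embeds_Delta (o o' : Bool) (i : Fin 4) :
    ¬ (chain o).C3.Embeds ((chain o').Delta (edgeSet i) (good_edgeSet i)) := fun h => by
  have hB := isArray_Delta o' (good_edgeSet i)
  obtain ⟨c, r, hc, hcycle⟩ := hB.exists_cycle_of_C3_embeds h
  have c_eq (a b : Fin 3) : c a = c b :=
    eq_of_deltaPattern_iff o o' i _ _ (by simp [hc])
  rw [c_eq 1 0, c_eq 2 0] at hcycle
  exact hB.not_cycle _ _ _ _ hcycle

theorem not_VT_embeds_C3 (o o' : Bool) : ¬ (chain o).VT.Embeds (chain o').C3 := fun h => by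
  obtain ⟨_, _, -, h0, h1⟩ :=
    (isArray_C3 o').exists_distinguished_of_VT_embeds (fun v => ⟨v.1, v.2, rfl⟩) h
  exact h1 h0

theorem not_VT_embeds_Delta (o o' : Bool) (i : Fin 4) :
    ¬ (chain o).VT.Embeds ((chain o').Delta (edgeSet i) (good_edgeSet i)) := fun h => by
  obtain ⟨c, k, hc, h0, h1⟩ := (isArray_Delta o' (good_edgeSet i)).exists_distinguished_of_VT_embeds
    (fun v => ⟨v.1, v.2, rfl⟩) h
  have c_eq : c 0 = c 1 := eq_of_deltaPattern_iff o o' i _ _ (by simp [hc])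
  exact h1 (c_eq ▸ h0)

theorem IsArray.orientation_eq_of_embeds {B : Tournament.{u}} {B' : Tournament.{v}}
    {κ κ' : Type*} [Finite κ] [Nonempty κ] [Finite κ'] {β : ℕ → κ → B.V} {β' : ℕ → κ' → B'.V}
    {o o' : Bool} (hB : B.IsArray β fun _ _ => o = true) (hB' : B'.IsArray β' fun _ _ => o' = true)
    (h : B.Embeds B') : o = o' := by
  obtain ⟨g⟩ := h
  obtain ⟨c, hc, -⟩ := hB.exists_column_map hB' g
  obtain ⟨i⟩ := ‹Nonempty κ›
  exact (Bool.eq_iff_iff.2 (hc i i)).symm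

theorem IsArray.not_Delta_embeds {B : Tournament.{u}} {κ : Type*} [Finite κ] {β : ℕ → κ → B.V}
    {o' : Bool} (hB : B.IsArray β fun _ _ => o' = true) (o : Bool) (i : Fin 4) :
    ¬ ((chain o).Delta (edgeSet i) (good_edgeSet i)).Embeds B := by
  rintro ⟨g⟩
  obtain ⟨c, hc, -⟩ := (isArray_Delta o (good_edgeSet i)).exists_column_map hB g
  exact zero_ne_one (eq_of_deltaPattern_iff o' o i 0 1 fun a _ b _ => (hc a b).symm)

theorem eq_of_Delta_embeds {o o' : Bool} {i i' : Fin 4}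
    (h : ((chain o).Delta (edgeSet i) (good_edgeSet i)).Embeds
      ((chain o').Delta (edgeSet i') (good_edgeSet i'))) : i = i' ∧ o = o' := by
  obtain ⟨g⟩ := h
  obtain ⟨c, hc, -⟩ :=
    (isArray_Delta o (good_edgeSet i)).exists_column_map (isArray_Delta o' (good_edgeSet i')) g
  exact deltaPattern_injective o o' i i' c hc

theorem eq_of_obstruction_embeds {p q : Option (Option (Fin 4)) × Bool}
    (h : (obstruction p).Embeds (obstruction q)) : p = q := by
  obtain ⟨_ | _ | i, o⟩ := p <;> obtain ⟨_ | _ | i', o'⟩ := q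
  · rw [(isArray_C3 o).orientation_eq_of_embeds (isArray_C3 o') h]
  · exact (not_C3_embeds_VT o o' h).elim
  · exact (not_C3_embeds_Delta o o' i' h).elim
  · exact (not_VT_embeds_C3 o o' h).elim
  · rw [(isArray_VT o).orientation_eq_of_embeds (isArray_VT o') h]
  · exact (not_VT_embeds_Delta o o' i' h).elim
  · exact ((isArray_C3 o').not_Delta_embeds o i h).elim
  · exact ((isArray_VT o').not_Delta_embeds o i h).elim
  · obtain ⟨rfl, rfl⟩ := eq_of_Delta_embeds h
    rfl

theorem eq_of_embeds {B B' : Tournament.{0}} (hB : B ∈ frakB) (hB' : B' ∈ frakB)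
    (h : B.Embeds B') : B = B' := by
  rw [frakB_eq_range] at hB hB'
  obtain ⟨p, rfl⟩ := hB
  obtain ⟨q, rfl⟩ := hB'
  rw [eq_of_obstruction_embeds h]

theorem encard_frakB : frakB.encard = 12 := by
  have hinj : Function.Injective obstruction := fun p q h =>
    eq_of_obstruction_embeds (h ▸ Embeds.refl _)
  rw [frakB_eq_range, ← Set.image_univ, hinj.encard_image, Set.encard_univ,
    ENat.card_eq_coe_natCard]
  simp

end Tournament

theorem corollary1 :
    -- every infinite tournament is a finite sum of acyclic ones or contains a member of `𝔅`
    (∀ T : Tournament.{u}, Infinite T.V →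
      (T.IsFiniteSumOfAcyclic ∨ ∃ B ∈ Tournament.frakB, B.Embeds T)) ∧
    -- the members of `𝔅`, twelve in number, do not embed in each other
    Tournament.frakB.encard = 12 ∧
    (∀ B ∈ Tournament.frakB, ∀ B' ∈ Tournament.frakB, B ≠ B' → ¬ B.Embeds B') ∧
    -- `𝔅` is a set of obstructions of minimum size
    Tournament.IsObstructionSet.{u, 0} Tournament.frakB ∧
    (∀ S : Set Tournament.{v}, Tournament.IsObstructionSet.{u, v} S →
      Tournament.frakB.encard ≤ S.encard) := by
  refine ⟨fun T _ => or_iff_not_imp_left.2 Tournament.isObstructionSet_frakB.exists_embeds,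
    Tournament.encard_frakB, fun B hB B' hB' hne h => hne (Tournament.eq_of_embeds hB hB' h),
    Tournament.isObstructionSet_frakB, fun S hS => ?_⟩
  exact Tournament.isObstructionSet_frakB.encard_le_encard.{u, v, 0}
    (fun B hB B' hB' => Tournament.eq_of_embeds hB hB') hS
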